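/- Let $K$ be a field of arbitrary characteristic, $V$ a $K$-vector space of finite dimension $\ell$, and $\Delta=(\alpha_1,\dots,\alpha_n)$ a finite sequence of elements spanning the dual space $V^*$ (zero forms, repetitions and proportional forms are allowed). Let $M(\Delta)$ be the matroid on $E=\{1,\dots,n\}$ in which $I\subseteq E$ is independent iff the family $(\alpha_i)_{i\in I}$ is linearly independent, let $r$ be its rank function, and let $$T(\Delta;x,y)=\sum_{A\subseteq E}(x-1)^{r(E)-r(A)}(y-1)^{|A|-r(A)}$$ be its Tutte polynomial. Let $P(\Delta)$ be the $K$-subspace of the symmetric algebra $\operatorname{Sym}(V^*)$ spanned by the products $\alpha_S=\prod_{i\in S}\alpha_i$, $S\subseteq E$, and let $$\operatorname{Hilb}(P(\Delta),t)=\sum_{d\ge 0}\dim_K\bigl(P(\Delta)\cap\operatorname{Sym}^d(V^*)\bigr)\,t^d .$$ Then $$\operatorname{Hilb}(P(\Delta),t)=t^{\,n-\ell}\,T(\Delta;1+t,1/t)$$ as Laurent series in $t$ with integer coefficients. Moreover, $\dim_K P(\Delta)$ equals the number of independent sets of $M(\Delta)$. -/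

import Mathlib

/-- The rank `r(A)` of a set in a matroid, as a natural number (meaningful for finite matroids). -/
noncomputable def Matroid.natRk {β : Type*} (M : Matroid β) (A : Set β) : ℕ :=
  (M.eRk A).toNat

/-- The Tutte polynomial `∑_{A ⊆ E} (x - 1)^{r(E) - r(A)} (y - 1)^{|A| - r(A)}` of a finite
matroid, where `x = X 0` and `y = X 1`. Both natural number subtractions are exact, since
`r(A) ≤ r(E)` and `r(A) ≤ |A|`. -/
noncomputable def Matroid.tuttePoly {β : Type*} (M : Matroid β) [M.Finite] :
    MvPolynomial (Fin 2) ℤ :=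
  ∑ A ∈ M.ground_finite.toFinset.powerset,
    (MvPolynomial.X 0 - 1) ^ (M.natRk M.E - M.natRk (A : Set β)) *
      (MvPolynomial.X 1 - 1) ^ (A.card - M.natRk (A : Set β))

section VectorConfiguration

variable {β K W : Type*} [Field K] [AddCommGroup W] [Module K W]

/-- Augmentation for linear independence of subfamilies of a finite family of vectors. -/
theorem linearIndepOn_augment [Finite β] (α : β → W) {I J : Set β}
    (hI : LinearIndepOn K α I) (hJ : LinearIndepOn K α J) (hIJ : I.ncard < J.ncard) :
    ∃ e ∈ J, e ∉ I ∧ LinearIndepOn K α (insert e I) := by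
  by_contra hcon
  push Not at hcon
  have hsub : Submodule.span K (α '' J) ≤ Submodule.span K (α '' I) := by
    rw [Submodule.span_le]
    rintro _ ⟨e, he, rfl⟩
    by_cases heI : e ∈ I
    · exact Submodule.subset_span ⟨e, heI, rfl⟩
    · by_contra hns
      exact hcon e he heI (hI.insert hns)
  have key : ∀ L : Set β, LinearIndepOn K α L →
      Module.finrank K (Submodule.span K (α '' L)) = L.ncard := by
    intro L hL
    have := Fintype.ofFinite L
    have h := finrank_span_eq_card (R := K) (b := fun x : L => α x) hL
    have hr : Set.range (fun x : L => α x) = α '' L := by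
      ext w; simp
    rw [hr] at h
    rw [h, Set.ncard_eq_toFinset_card', Set.toFinset_card]
  have : FiniteDimensional K (Submodule.span K (α '' I)) :=
    FiniteDimensional.span_of_finite K (Set.toFinite _)
  have hle := Submodule.finrank_mono hsub
  rw [key I hI, key J hJ] at hle
  omega

/-- The matroid `M(Δ)` of a finite family `Δ = (α_i)` of vectors, on the index set of the family:
a set of indices is independent iff the corresponding subfamily is linearly independent. -/
noncomputable def vectorMatroid (K : Type*) {β W : Type*} [Field K] [AddCommGroup W] [Module K W]
    [Finite β] (α : β → W) : Matroid β :=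
  (IndepMatroid.ofFinite (E := Set.univ) Set.finite_univ (fun I => LinearIndepOn K α I)
    (linearIndepOn_empty K α) (fun _ _ hJ hIJ => hJ.mono hIJ)
    (fun _ _ hI hJ hIJ => linearIndepOn_augment α hI hJ hIJ)
    (fun _ _ => Set.subset_univ _)).matroid

instance vectorMatroid_finite [Finite β] (α : β → W) : (vectorMatroid K α).Finite :=
  ⟨Set.finite_univ⟩

/-- The space `P(Δ)`: the `K`-span in `Sym(W)` of the products `α_S = ∏_{i ∈ S} α_i`, over all
sets `S` of indices. -/
def productSpace (K : Type*) {β W : Type*} [Field K] [AddCommGroup W] [Module K W]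
    (α : β → W) : Submodule K (SymmetricAlgebra K W) :=
  Submodule.span K (Set.range fun S : Finset β => ∏ i ∈ S, SymmetricAlgebra.ι K W (α i))

/-- The homogeneous component `Sym^d(W)`: the span of all products of `d` elements of `W`. -/
def symPower (K W : Type*) [Field K] [AddCommGroup W] [Module K W] (d : ℕ) :
    Submodule K (SymmetricAlgebra K W) :=
  LinearMap.range (SymmetricAlgebra.ι K W) ^ d

/-- The Hilbert series `∑_{d ≥ 0} dim(P ∩ Sym^d(W)) t^d` of a subspace `P` of `Sym(W)`. -/
noncomputable def hilbertSeries {K W : Type*} [Field K] [AddCommGroup W] [Module K W]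
    (P : Submodule K (SymmetricAlgebra K W)) : PowerSeries ℤ :=
  PowerSeries.mk fun d => (Module.finrank K (P ⊓ symPower K W d : Submodule K _) : ℤ)

end VectorConfiguration

-- Everything rests on deletion-contraction. For `α_e ≠ 0`, the quotient map `Sym(W) → Sym(W / α_e)`
-- gives an exact sequence `0 → P(Δ \ e) → P(Δ) → P(Δ / e) → 0` whose first map is multiplication by
-- `α_e`, so it raises degree by one. Hence `Hilb(Δ) = t Hilb(Δ \ e) + Hilb(Δ / e)`, for coloops
-- too, while a zero form changes nothing. The sum `∑_A t^(n - |A|) (1 - t)^(|A| - r(A))`, which is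
-- `t^(n - ℓ) T(1 + t, 1/t)` with denominators cleared, obeys the same recursion
-- (`nullitySum_insert`).
--
-- The hard point is exactness in the middle: an element of `P(Δ)` divisible by `α_e` must have its
-- quotient in `P(Δ \ e)`. This follows from `SatisfiesSyzygies.sum_smul_eq_zero`: a map on subsets
-- that respects the linear syzygies respects every linear relation among the products. At `t = 1`
-- the sum counts independent sets, which gives the total dimension.

universe u v

open Finset Submodule

/-! ### Linear relations among the products -/

section Syzygies

variable {β : Type*} {K : Type u} [Field K]

/-- The product `α_S = ∏_{i ∈ S} α_i` in the symmetric algebra. -/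
noncomputable def subsetProd (K : Type u) [Field K] {W : Type v} [AddCommGroup W] [Module K W]
    (α : β → W) (S : Finset β) : SymmetricAlgebra K W :=
  ∏ i ∈ S, SymmetricAlgebra.ι K W (α i)

theorem subsetProd_insert [DecidableEq β] {W : Type v} [AddCommGroup W] [Module K W] (α : β → W)
    {e : β} {S : Finset β} (he : e ∉ S) :
    subsetProd K α (insert e S) = SymmetricAlgebra.ι K W (α e) * subsetProd K α S :=
  prod_insert he

/-- A functional not vanishing at `w` extends to an algebra map `Sym(W) → K`. Since `Sym(W)` is a
domain, this makes multiplication by `w` injective. -/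
theorem SymmetricAlgebra.ι_ne_zero {W : Type v} [AddCommGroup W] [Module K W] {w : W}
    (hw : w ≠ 0) : SymmetricAlgebra.ι K W w ≠ 0 := by
  intro h
  obtain ⟨f, hf⟩ : ∃ f : Module.Dual K W, f w ≠ 0 := by
    by_contra! hcon
    exact hw ((Module.forall_dual_apply_eq_zero_iff K w).1 hcon)
  apply hf
  rw [← SymmetricAlgebra.lift_ι_apply f w, h, map_zero]

/-- The map `Sym(W) → Sym(W / U)` induced by the quotient map. -/
noncomputable def symQuotient {W : Type v} [AddCommGroup W] [Module K W] (U : Submodule K W) :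
    SymmetricAlgebra K W →ₐ[K] SymmetricAlgebra K (W ⧸ U) :=
  SymmetricAlgebra.lift (SymmetricAlgebra.ι K (W ⧸ U) ∘ₗ U.mkQ)

theorem symQuotient_subsetProd {W : Type v} [AddCommGroup W] [Module K W] (U : Submodule K W)
    (α : β → W) (S : Finset β) :
    symQuotient U (subsetProd K α S) = subsetProd K (fun i => U.mkQ (α i)) S := by
  simp [symQuotient, subsetProd, map_prod]

variable [DecidableEq β]

/-- A map `φ` on finite sets satisfies the linear syzygies of `α` on `s` if every linear relation
`∑_{i ∈ C} a_i α_i = 0` gives `∑_{i ∈ C} a_i φ(T ∪ {i}) = 0`, whenever `C` and `T` are disjoint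
subsets of `s`. -/
def SatisfiesSyzygies {W : Type v} [AddCommGroup W] [Module K W] {M : Type*} [AddCommGroup M]
    [Module K M] (α : β → W) (s : Finset β) (φ : Finset β → M) : Prop :=
  ∀ C T : Finset β, C ⊆ s → T ⊆ s → Disjoint C T → ∀ a : β → K,
    ∑ i ∈ C, a i • α i = 0 → ∑ i ∈ C, a i • φ (insert i T) = 0

namespace SatisfiesSyzygies

variable {W : Type v} [AddCommGroup W] [Module K W] {M N : Type*} [AddCommGroup M]
  [Module K M] [AddCommGroup N] [Module K N] {α : β → W} {s : Finset β} {φ : Finset β → M}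

theorem mono {t : Finset β} (h : SatisfiesSyzygies (K := K) α t φ) (hst : s ⊆ t) :
    SatisfiesSyzygies (K := K) α s φ :=
  fun C T hC hT => h C T (hC.trans hst) (hT.trans hst)

theorem prodMk {ψ : Finset β → N} (h : SatisfiesSyzygies (K := K) α s φ)
    (h' : SatisfiesSyzygies (K := K) α s ψ) :
    SatisfiesSyzygies (K := K) α s (fun S => (φ S, ψ S)) := by
  intro C T hC hT hCT a ha
  ext
  · simpa [Prod.fst_sum] using h C T hC hT hCT a ha
  · simpa [Prod.snd_sum] using h' C T hC hT hCT a ha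

variable (α s) in
theorem subsetProd : SatisfiesSyzygies (K := K) α s (subsetProd K α) := by
  intro C T _ _ hCT a ha
  have : ∀ i ∈ C, a i • _root_.subsetProd K α (insert i T) =
      SymmetricAlgebra.ι K W (a i • α i) * _root_.subsetProd K α T := fun i hi => by
    rw [subsetProd_insert α (disjoint_left.1 hCT hi), map_smul, smul_mul_assoc]
  rw [sum_congr rfl this, ← sum_mul, ← map_sum, ha, map_zero, zero_mul]

/-- The syzygies are homogeneous: all sets `T ∪ {i}` in one of them have size `|T| + 1`. -/
theorem restrictCard (D : Set ℕ) [DecidablePred (· ∈ D)] (h : SatisfiesSyzygies (K := K) α s φ) :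
    SatisfiesSyzygies (K := K) α s (fun S => if S.card ∈ D then φ S else 0) := by
  intro C T hC hT hCT a ha
  by_cases hD : T.card + 1 ∈ D
  · refine (sum_congr rfl fun i hi => ?_).trans (h C T hC hT hCT a ha)
    simp only [card_insert_of_notMem (disjoint_left.1 hCT hi), if_pos hD]
  · refine sum_eq_zero fun i hi => ?_
    simp only [card_insert_of_notMem (disjoint_left.1 hCT hi), if_neg hD, smul_zero]

theorem deletion {e : β} (he : e ∉ s) (h : SatisfiesSyzygies (K := K) α (insert e s) φ) :
    SatisfiesSyzygies (K := K) α s (fun S => φ (insert e S)) := by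
  intro C T hC hT hCT a ha
  have := h C (insert e T) (hC.trans (subset_insert _ _)) (insert_subset_insert _ hT)
    (disjoint_insert_right.2 ⟨fun h => he (hC h), hCT⟩) a ha
  rw [← this]
  exact sum_congr rfl fun i _ => by rw [Finset.insert_comm]

/-- A relation modulo `α_e` lifts to a relation that involves `e`; its extra term `φ(T ∪ {e})` dies
in the quotient of the target. -/
theorem contraction {e : β} (he : e ∉ s) (h : SatisfiesSyzygies (K := K) α (insert e s) φ) :
    SatisfiesSyzygies (K := K) (fun i => (span K {α e}).mkQ (α i)) s
      (fun S => (span K ((fun T => φ (insert e T)) '' (s.powerset : Set (Finset β)))).mkQ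
        (φ S)) := by
  intro C T hC hT hCT a ha
  simp only [← map_smul, ← map_sum] at ha ⊢
  rw [mkQ_apply, Quotient.mk_eq_zero] at ha ⊢
  obtain ⟨b, hb⟩ := mem_span_singleton.1 ha
  have heC : e ∉ C := fun h => he (hC h)
  have key := h (insert e C) T (insert_subset_insert _ hC) (hT.trans (subset_insert _ _))
    (disjoint_insert_left.2 ⟨fun h => he (hT h), hCT⟩) (Function.update a e (-b))
  have hupd : ∀ i ∈ C, Function.update a e (-b) i = a i := fun i hi =>
    Function.update_of_ne (ne_of_mem_of_not_mem hi heC) _ _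
  rw [sum_insert heC, sum_insert heC, Function.update_self,
    sum_congr rfl fun i hi => by rw [hupd i hi], ← hb,
    sum_congr rfl fun i hi => by rw [hupd i hi]] at key
  have := key (by simp)
  rw [neg_smul, neg_add_eq_zero] at this
  rw [← this]
  exact smul_mem _ _ (subset_span ⟨T, by simpa using hT, rfl⟩)

end SatisfiesSyzygies

theorem symQuotient_sum_powerset_insert {W : Type v} [AddCommGroup W] [Module K W] {α : β → W}
    {e : β} {s : Finset β} (he : e ∉ s) (c : Finset β → K) :
    symQuotient (span K {α e}) (∑ S ∈ (insert e s).powerset, c S • subsetProd K α S) =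
      ∑ S ∈ s.powerset, c S • subsetProd K (fun i => (span K {α e}).mkQ (α i)) S := by
  simp only [map_sum, map_smul, symQuotient_subsetProd]
  rw [sum_powerset_insert he, add_eq_left]
  refine sum_eq_zero fun S hS => ?_
  have h0 : (span K {α e}).mkQ (α e) = 0 := by
    rw [mkQ_apply, Quotient.mk_eq_zero]; exact mem_span_singleton_self _
  rw [subsetProd_insert _ (fun h => he (mem_powerset.1 hS h)), h0, map_zero, zero_mul, smul_zero]

/-- The linear relations between the products `α_S` are generated by the linear syzygies. -/
theorem SatisfiesSyzygies.sum_smul_eq_zero {W : Type v} [AddCommGroup W] [Module K W]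
    {M : Type max u v} [AddCommGroup M] [Module K M] {α : β → W} {s : Finset β}
    {φ : Finset β → M} (h : SatisfiesSyzygies (K := K) α s φ) {c : Finset β → K}
    (hc : ∑ S ∈ s.powerset, c S • _root_.subsetProd K α S = 0) :
    ∑ S ∈ s.powerset, c S • φ S = 0 := by
  induction s using Finset.induction_on generalizing W M φ c with
  | empty =>
    have : c ∅ = 0 := by simpa [_root_.subsetProd] using hc
    simp [this]
  | insert e s he ih =>
    by_cases hαe : α e = 0
    · have h0 : ∀ S ∈ s.powerset, φ (insert e S) = 0 := fun S hS => by
        have := h {e} S (by simp) ((mem_powerset.1 hS).trans (subset_insert _ _))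
          (disjoint_singleton_left.2 fun h => he (mem_powerset.1 hS h)) 1 (by simp [hαe])
        simpa using this
      rw [sum_powerset_insert he] at hc ⊢
      rw [sum_eq_zero (s := s.powerset) (f := fun S => c (insert e S) • φ (insert e S))
        (fun S hS => by rw [h0 S hS, smul_zero]), add_zero]
      refine ih (h.mono (subset_insert _ _)) ?_
      rw [← hc, left_eq_add]
      refine sum_eq_zero fun S hS => ?_
      rw [subsetProd_insert _ (fun h => he (mem_powerset.1 hS h)), hαe, map_zero, zero_mul,
        smul_zero]
    · have hq := symQuotient_sum_powerset_insert (K := K) (α := α) he c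
      rw [hc, map_zero] at hq
      -- Pairing `φ` with `subsetProd` makes one choice of coefficients `b` rewrite both sums over
      -- subsets avoiding `e` as sums over subsets containing `e`.
      have hmem := ih (h.prodMk (SatisfiesSyzygies.subsetProd α (insert e s)) |>.contraction he)
        hq.symm
      simp only [← map_smul, ← map_sum] at hmem
      rw [mkQ_apply, Quotient.mk_eq_zero, mem_span_image_finset_iff_exists_fun'] at hmem
      obtain ⟨b, hb⟩ := hmem
      have hb1 := congrArg Prod.fst hb
      have hb2 := congrArg Prod.snd hb
      simp only [Prod.fst_sum, Prod.snd_sum, Prod.smul_fst, Prod.smul_snd] at hb1 hb2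
      rw [sum_powerset_insert he] at hc ⊢
      rw [← hb2, ← sum_add_distrib] at hc
      rw [← hb1, ← sum_add_distrib]
      simp only [← add_smul] at hc ⊢
      refine ih (h.deletion he) (c := fun S => b S + c (insert e S)) ?_
      -- The relation is now `α_e` times a relation among products avoiding `e`, and `α_e` cancels.
      refine (mul_eq_zero.1 ?_).resolve_left (SymmetricAlgebra.ι_ne_zero (K := K) hαe)
      rw [← hc, mul_sum]
      refine sum_congr rfl fun S hS => ?_
      rw [subsetProd_insert _ (fun h => he (mem_powerset.1 hS h)), mul_smul_comm]

end Syzygies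

/-! ### Dimensions of the product spaces -/

section Dimension

variable {β : Type*} {K : Type u} [Field K]

/-- The span of the products `α_S` over the subsets `S` of `s` whose size lies in `D`. -/
noncomputable def cardProductSpace (K : Type u) [Field K] {W : Type v} [AddCommGroup W]
    [Module K W] (α : β → W) (s : Finset β) (D : Set ℕ) : Submodule K (SymmetricAlgebra K W) :=
  span K (subsetProd K α '' {S | S ⊆ s ∧ S.card ∈ D})

instance cardProductSpace_finite {W : Type v} [AddCommGroup W] [Module K W] (α : β → W)
    (s : Finset β) (D : Set ℕ) : FiniteDimensional K (cardProductSpace K α s D) :=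
  FiniteDimensional.span_of_finite K
    ((s.powerset.finite_toSet.subset fun _ hS => by simpa using hS.1).image _)

theorem mem_cardProductSpace_iff {W : Type v} [AddCommGroup W] [Module K W] {α : β → W}
    {s : Finset β} {D : Set ℕ} [DecidablePred (· ∈ D)] {f : SymmetricAlgebra K W} :
    f ∈ cardProductSpace K α s D ↔
      ∃ c : Finset β → K, (∀ S, S.card ∉ D → c S = 0) ∧
        ∑ S ∈ s.powerset, c S • subsetProd K α S = f := by
  have : {S | S ⊆ s ∧ S.card ∈ D} = ((s.powerset.filter (·.card ∈ D) : Finset (Finset β)) :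
      Set (Finset β)) := by ext; simp
  rw [cardProductSpace, this, mem_span_image_finset_iff_exists_fun']
  constructor
  · rintro ⟨c, rfl⟩
    refine ⟨fun S => if S.card ∈ D then c S else 0, fun S hS => if_neg hS, ?_⟩
    rw [sum_filter]
    refine sum_congr rfl fun S _ => ?_
    dsimp only
    split_ifs <;> simp
  · rintro ⟨c, hc, rfl⟩
    refine ⟨c, ?_⟩
    rw [sum_filter]
    refine sum_congr rfl fun S _ => ?_
    split_ifs with h
    · rfl
    · rw [hc S h, zero_smul]

variable {W : Type v} [AddCommGroup W] [Module K W]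

theorem cardProductSpace_empty (α : β → W) (s : Finset β) :
    cardProductSpace K α s ∅ = ⊥ := by
  have : {S : Finset β | S ⊆ s ∧ S.card ∈ (∅ : Set ℕ)} = ∅ :=
    Set.eq_empty_iff_forall_notMem.2 fun _ hS => hS.2
  rw [cardProductSpace, this, Set.image_empty, span_empty]

theorem finrank_span_image_le_card (α : β → W) (A : Finset β) :
    Module.finrank K (span K (α '' (A : Set β))) ≤ A.card := by
  classical
  rw [← coe_image]
  exact (finrank_span_finset_le_card _).trans card_image_le

theorem finrank_cardProductSpace_of_empty (α : β → W) (D : Set ℕ) [Decidable (0 ∈ D)] :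
    Module.finrank K (cardProductSpace K α ∅ D) = if 0 ∈ D then 1 else 0 := by
  have hone : subsetProd K α ∅ = 1 := prod_empty
  split_ifs with h
  · have : subsetProd K α '' {S | S ⊆ ∅ ∧ S.card ∈ D} = {1} := by
      ext f
      constructor
      · rintro ⟨S, ⟨hS, -⟩, rfl⟩
        rw [subset_empty.1 hS, hone]; rfl
      · rintro rfl
        exact ⟨∅, ⟨Finset.Subset.refl _, h⟩, hone⟩
    rw [cardProductSpace, this]
    exact finrank_span_singleton one_ne_zero
  · have : {S : Finset β | S ⊆ ∅ ∧ S.card ∈ D} = ∅ := by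
      refine Set.eq_empty_iff_forall_notMem.2 fun S hS => h ?_
      have := hS.2
      rwa [subset_empty.1 hS.1] at this
    rw [cardProductSpace, this, Set.image_empty, span_empty, finrank_bot]

/-- The sum `∑_{A ⊆ s} t^{|s| - |A|} (1 - t)^{|A| - r(A)}`, where `r` is the linear rank. -/
noncomputable def nullitySum (K : Type u) [Field K] {W : Type v} [AddCommGroup W] [Module K W]
    {R : Type*} [CommRing R] (α : β → W) (s : Finset β) (t : R) : R :=
  ∑ A ∈ s.powerset, t ^ (s.card - A.card) *
    (1 - t) ^ (A.card - Module.finrank K (span K (α '' (A : Set β))))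

/-! ### Deletion and contraction -/

section DeletionContraction

variable [DecidableEq β] {α : β → W} {s : Finset β} {e : β}

theorem cardProductSpace_insert_of_eq_zero (hα : α e = 0) (D : Set ℕ) :
    cardProductSpace K α (insert e s) D = cardProductSpace K α s D := by
  refine le_antisymm (span_le.2 ?_) (span_mono (Set.image_mono fun S hS =>
    ⟨hS.1.trans (subset_insert _ _), hS.2⟩))
  rintro _ ⟨S, ⟨hS, hD⟩, rfl⟩
  by_cases heS : e ∈ S
  · have : subsetProd K α S = 0 := prod_eq_zero heS (by rw [hα, map_zero])
    rw [this]; exact zero_mem _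
  · exact subset_span ⟨S, ⟨(subset_insert_iff_of_notMem heS).1 hS, hD⟩, rfl⟩

theorem map_symQuotient_cardProductSpace_insert (D : Set ℕ) :
    (cardProductSpace K α (insert e s) D).map (symQuotient (span K {α e})).toLinearMap =
      cardProductSpace K (fun i => (span K {α e}).mkQ (α i)) s D := by
  have h0 : (span K {α e}).mkQ (α e) = 0 := by
    rw [mkQ_apply, Quotient.mk_eq_zero]; exact mem_span_singleton_self _
  rw [← cardProductSpace_insert_of_eq_zero (α := fun i => (span K {α e}).mkQ (α i)) h0,
    cardProductSpace, cardProductSpace, map_span, ← Set.image_comp]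
  congr 2
  funext S
  exact symQuotient_subsetProd _ _ _

/-- An element of `P(Δ)` lies in the kernel of `Sym(W) → Sym(W / α_e)` iff it is `α_e` times an
element of `P(Δ \ e)`. -/
theorem cardProductSpace_insert_inf_ker (he : e ∉ s) (D : Set ℕ) :
    cardProductSpace K α (insert e s) D ⊓ LinearMap.ker (symQuotient (span K {α e})).toLinearMap =
      (cardProductSpace K α s {d | d + 1 ∈ D}).map
        (LinearMap.mulLeft K (SymmetricAlgebra.ι K W (α e))) := by
  classical
  have hmap : (cardProductSpace K α s {d | d + 1 ∈ D}).map
      (LinearMap.mulLeft K (SymmetricAlgebra.ι K W (α e))) =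
      span K ((fun T => if (insert e T).card ∈ D then subsetProd K α (insert e T) else 0) ''
        (s.powerset : Set (Finset β))) := by
    rw [cardProductSpace, map_span]
    refine le_antisymm (span_mono ?_) (span_le.2 ?_)
    · rintro _ ⟨_, ⟨S, ⟨hS, hD⟩, rfl⟩, rfl⟩
      have heS : e ∉ S := fun h => he (hS h)
      refine ⟨S, by simpa using hS, ?_⟩
      simp only [card_insert_of_notMem heS]
      exact (if_pos hD).trans (subsetProd_insert _ heS)
    · rintro _ ⟨S, hS, rfl⟩
      have hS : S ⊆ s := by simpa using hS
      have heS : e ∉ S := fun h => he (hS h)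
      simp only [card_insert_of_notMem heS]
      split_ifs with hD
      · refine subset_span ⟨_, ⟨S, ⟨hS, hD⟩, rfl⟩, ?_⟩
        rw [subsetProd_insert _ heS, LinearMap.mulLeft_apply]
      · exact zero_mem _
  rw [hmap]
  refine le_antisymm ?_ (span_le.2 ?_)
  · rintro f ⟨hf, hker⟩
    obtain ⟨c, hc, rfl⟩ := mem_cardProductSpace_iff.1 hf
    have h0 : symQuotient (span K {α e})
        (∑ S ∈ (insert e s).powerset, c S • subsetProd K α S) = 0 := hker
    rw [symQuotient_sum_powerset_insert he] at h0
    -- A relation in the contraction is transported to `Sym(W)` modulo the products containing `e`;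
    -- truncating to sizes in `D` keeps track of degrees.
    have key := (((SatisfiesSyzygies.subsetProd (K := K) α (insert e s)).restrictCard
      D).contraction he).sum_smul_eq_zero h0
    simp only [← map_smul, ← map_sum] at key
    rw [mkQ_apply, Quotient.mk_eq_zero] at key
    rw [sum_powerset_insert he]
    refine add_mem ?_ (sum_mem fun S hS => ?_)
    · convert key using 1
      refine sum_congr rfl fun S _ => ?_
      split_ifs with h
      · rfl
      · rw [hc S h, zero_smul, zero_smul]
    · by_cases h : (insert e S).card ∈ D
      · exact smul_mem _ _ (subset_span ⟨S, hS, if_pos h⟩)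
      · rw [hc _ h, zero_smul]; exact zero_mem _
  · rintro _ ⟨S, hS, rfl⟩
    have hS : S ⊆ s := by simpa using hS
    have heS : e ∉ S := fun h => he (hS h)
    dsimp only
    split_ifs with hD
    · refine ⟨subset_span ⟨_, ⟨insert_subset_insert _ hS, hD⟩, rfl⟩, ?_⟩
      have h0 : (span K {α e}).mkQ (α e) = 0 := by
        rw [mkQ_apply, Quotient.mk_eq_zero]; exact mem_span_singleton_self _
      change symQuotient (span K {α e}) _ = 0
      rw [symQuotient_subsetProd, subsetProd_insert _ heS, h0, map_zero, zero_mul]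
    · exact zero_mem _

/-- Deletion-contraction for the dimension of the space of products. -/
theorem finrank_cardProductSpace_insert (he : e ∉ s) (hα : α e ≠ 0) (D : Set ℕ) :
    Module.finrank K (cardProductSpace K α (insert e s) D) =
      Module.finrank K (cardProductSpace K α s {d | d + 1 ∈ D}) +
      Module.finrank K
        (cardProductSpace K (fun i => (span K {α e}).mkQ (α i)) s D) := by
  rw [← LinearMap.finrank_range_add_finrank_ker
    ((symQuotient (span K {α e})).toLinearMap.domRestrict (cardProductSpace K α (insert e s) D)),
    LinearMap.range_domRestrict, map_symQuotient_cardProductSpace_insert, add_comm]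
  congr 1
  rw [LinearMap.ker_domRestrict, ← finrank_map_subtype_eq, map_comap_subtype,
    cardProductSpace_insert_inf_ker he]
  -- The kernel is a copy of the deletion's space, multiplied by `α_e`.
  exact (equivMapOfInjective _ (mul_right_injective₀ (SymmetricAlgebra.ι_ne_zero hα))
    _).finrank_eq.symm

theorem finrank_span_image_insert (hα : α e ≠ 0) (A : Finset β) :
    Module.finrank K (span K (α '' (insert e A : Finset β))) =
      Module.finrank K
        (span K ((fun i => (span K {α e}).mkQ (α i)) '' (A : Set β))) + 1 := by
  have hle : span K {α e} ≤ span K (α '' (insert e A : Finset β)) :=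
    span_mono (by simp)
  have : FiniteDimensional K (span K (α '' (insert e A : Finset β))) :=
    FiniteDimensional.span_of_finite K ((Finset.finite_toSet _).image _)
  have hmap : (span K (α '' (insert e A : Finset β))).map (span K {α e}).mkQ =
      span K ((fun i => (span K {α e}).mkQ (α i)) '' (A : Set β)) := by
    have h0 : (span K {α e}).mkQ (α e) = 0 := by
      rw [mkQ_apply, Quotient.mk_eq_zero]; exact mem_span_singleton_self _
    rw [map_span, ← Set.image_comp, coe_insert, Set.image_insert_eq]
    simp only [Function.comp_def, h0, span_insert_zero]
  rw [← LinearMap.finrank_range_add_finrank_ker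
    ((span K {α e}).mkQ.domRestrict (span K (α '' (insert e A : Finset β)))),
    LinearMap.range_domRestrict, hmap, LinearMap.ker_domRestrict, ← finrank_map_subtype_eq,
    map_comap_subtype, ker_mkQ, inf_eq_right.2 hle, finrank_span_singleton hα]

variable {R : Type*} [CommRing R]

/-- The terms of `A` and `A ∪ {e}` are `t` and `1 - t` times the old term of `A`. -/
theorem nullitySum_insert_of_eq_zero (he : e ∉ s) (hα : α e = 0) (t : R) :
    nullitySum K α (insert e s) t = nullitySum K α s t := by
  rw [nullitySum, nullitySum, sum_powerset_insert he, ← sum_add_distrib]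
  refine sum_congr rfl fun A hA => ?_
  have hA := mem_powerset.1 hA
  have h1 := card_le_card hA
  have h2 := finrank_span_image_le_card (K := K) α A
  rw [card_insert_of_notMem he, card_insert_of_notMem (fun h => he (hA h)), coe_insert,
    Set.image_insert_eq, hα, span_insert_zero, Nat.add_sub_add_right, Nat.sub_add_comm h1,
    Nat.sub_add_comm h2]
  ring

theorem nullitySum_insert (he : e ∉ s) (hα : α e ≠ 0) (t : R) :
    nullitySum K α (insert e s) t = t * nullitySum K α s t +
      nullitySum K (fun i => (span K {α e}).mkQ (α i)) s t := by
  rw [nullitySum, nullitySum, nullitySum, sum_powerset_insert he, mul_sum]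
  congr 1 <;> refine sum_congr rfl fun A hA => ?_
  · have h1 := card_le_card (mem_powerset.1 hA)
    rw [card_insert_of_notMem he, Nat.sub_add_comm h1]
    ring
  · rw [card_insert_of_notMem he, card_insert_of_notMem (fun h => he (mem_powerset.1 hA h)),
      finrank_span_image_insert hα, Nat.add_sub_add_right, Nat.add_sub_add_right]

end DeletionContraction

theorem finrank_cardProductSpace_univ (α : β → W) (s : Finset β) :
    (Module.finrank K (cardProductSpace K α s Set.univ) : ℤ) = nullitySum K α s 1 := by
  classical
  induction s using Finset.induction_on generalizing W with
  | empty => simp [finrank_cardProductSpace_of_empty, nullitySum]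
  | insert e s he ih =>
    by_cases hα : α e = 0
    · rw [cardProductSpace_insert_of_eq_zero hα, nullitySum_insert_of_eq_zero he hα, ih]
    · rw [finrank_cardProductSpace_insert he hα, nullitySum_insert he hα, Nat.cast_add, ← ih,
        ← ih, one_mul]
      -- The shifted index set `{d | d + 1 ∈ Set.univ}` is `Set.univ` by definition.
      rfl

theorem mk_finrank_cardProductSpace (α : β → W) (s : Finset β) :
    (PowerSeries.mk fun d => (Module.finrank K (cardProductSpace K α s {d}) : ℤ)) =
      nullitySum K α s PowerSeries.X := by
  classical
  induction s using Finset.induction_on generalizing W with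
  | empty =>
    ext d
    simp [finrank_cardProductSpace_of_empty, nullitySum, PowerSeries.coeff_one, eq_comm]
  | insert e s he ih =>
    by_cases hα : α e = 0
    · rw [nullitySum_insert_of_eq_zero he hα, ← ih]
      ext d
      rw [PowerSeries.coeff_mk, PowerSeries.coeff_mk, cardProductSpace_insert_of_eq_zero hα]
    · rw [nullitySum_insert he hα, ← ih, ← ih]
      ext d
      simp only [finrank_cardProductSpace_insert he hα, map_add, PowerSeries.coeff_mk,
        Nat.cast_add]
      congr 1
      cases d with
      | zero =>
        have : {d | d + 1 ∈ ({0} : Set ℕ)} = ∅ := by ext; simp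
        rw [this, PowerSeries.coeff_zero_X_mul, cardProductSpace_empty, finrank_bot, Nat.cast_zero]
      | succ d =>
        have : {k | k + 1 ∈ ({d + 1} : Set ℕ)} = {d} := by ext; simp
        rw [this, PowerSeries.coeff_succ_X_mul, PowerSeries.coeff_mk]

end Dimension

/-! ### Degrees in the symmetric algebra -/

section Grading

variable {β : Type*} {K : Type u} [Field K] {W : Type v} [AddCommGroup W] [Module K W]

/-- The homomorphism `Sym(W) → Sym(W)[X]` with `w ↦ w X`, which records degrees. -/
noncomputable def symDegreeHom (K : Type u) (W : Type v) [Field K] [AddCommGroup W] [Module K W] :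
    SymmetricAlgebra K W →ₐ[K] Polynomial (SymmetricAlgebra K W) :=
  SymmetricAlgebra.lift
    ((Polynomial.monomial 1).restrictScalars K ∘ₗ SymmetricAlgebra.ι K W)

theorem symDegreeHom_apply_of_mem {d : ℕ} {f : SymmetricAlgebra K W} (hf : f ∈ symPower K W d) :
    symDegreeHom K W f = Polynomial.monomial d f := by
  unfold symPower at hf
  induction hf using Submodule.pow_induction_on_left' with
  | algebraMap r => simp [AlgHom.commutes, Polynomial.algebraMap_apply]
  | add x y i hx hy ihx ihy => rw [map_add, ihx, ihy, map_add]
  | mem_mul m hm i x hx ih =>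
    obtain ⟨w, rfl⟩ := hm
    rw [map_mul, ih, symDegreeHom, SymmetricAlgebra.lift_ι_apply, LinearMap.comp_apply,
      LinearMap.restrictScalars_apply, Polynomial.monomial_mul_monomial, add_comm]

theorem subsetProd_mem_symPower (α : β → W) (S : Finset β) :
    subsetProd K α S ∈ symPower K W S.card := by
  classical
  induction S using Finset.induction_on with
  | empty => simp [subsetProd, symPower, Submodule.one_le.1]
  | insert e S he ih =>
    rw [subsetProd_insert α he, card_insert_of_notMem he, symPower, pow_succ']
    exact mul_mem_mul ⟨_, rfl⟩ ih

end Grading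

/-! ### Matroid rank as linear rank -/

section Rank

variable {β : Type*} {K : Type u} [Field K] {W : Type v} [AddCommGroup W] [Module K W]

theorem vectorMatroid_indep_iff [Finite β] (α : β → W) (I : Set β) :
    (vectorMatroid K α).Indep I ↔ LinearIndepOn K α I := Iff.rfl

theorem LinearIndepOn.finrank_span_image [Finite β] {α : β → W} {I : Set β} (hI : LinearIndepOn K α I) :
    Module.finrank K (span K (α '' I)) = I.ncard := by
  have := Fintype.ofFinite I
  rw [Set.image_eq_range, finrank_span_eq_card hI, Set.ncard_eq_toFinset_card',
    Set.toFinset_card]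

theorem vectorMatroid_natRk [Finite β] (α : β → W) (A : Set β) :
    (vectorMatroid K α).natRk A = Module.finrank K (span K (α '' A)) := by
  obtain ⟨I, hI⟩ := (vectorMatroid K α).exists_isBasis A (Set.subset_univ A)
  have hspan : span K (α '' A) = span K (α '' I) := by
    refine le_antisymm (span_le.2 ?_) (span_mono (Set.image_mono hI.subset))
    rintro _ ⟨e, he, rfl⟩
    by_contra hns
    refine hns (subset_span ⟨e, ?_, rfl⟩)
    exact hI.mem_of_insert_indep he (LinearIndepOn.insert (K := K) hI.indep hns)
  rw [Matroid.natRk, hI.eRk_eq_encard, hspan,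
    LinearIndepOn.finrank_span_image (K := K) hI.indep, Set.ncard]

theorem finrank_span_image_eq_card_iff (α : β → W) (A : Finset β) :
    Module.finrank K (span K (α '' (A : Set β))) = A.card ↔ LinearIndepOn K α (A : Set β) := by
  rw [LinearIndepOn, linearIndependent_iff_card_eq_finrank_span, Set.finrank, ← Set.image_eq_range,
    eq_comm]
  simp

end Rank

/-! ### Hilbert series, independent sets and the Tutte polynomial -/

section Assembly

variable {β : Type*} {K : Type u} [Field K] {W : Type v} [AddCommGroup W] [Module K W]

theorem productSpace_eq_cardProductSpace [Fintype β] (α : β → W) :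
    productSpace K α = cardProductSpace K α univ Set.univ := by
  have : {S : Finset β | S ⊆ univ ∧ S.card ∈ Set.univ} = Set.univ :=
    Set.eq_univ_of_forall fun S => ⟨subset_univ S, Set.mem_univ _⟩
  rw [cardProductSpace, this, Set.image_univ]
  rfl

theorem productSpace_inf_symPower [Fintype β] (α : β → W) (d : ℕ) :
    productSpace K α ⊓ symPower K W d = cardProductSpace K α univ {d} := by
  refine le_antisymm ?_ (span_le.2 ?_)
  · rintro f ⟨hf, hd⟩
    -- `π` is the projection onto degree `d`; it sends each generator `α_S` to itself or to zero.
    let π : SymmetricAlgebra K W →ₗ[K] SymmetricAlgebra K W :=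
      (Polynomial.lcoeff (SymmetricAlgebra K W) d).restrictScalars K ∘ₗ
        (symDegreeHom K W).toLinearMap
    have hπ : ∀ k, ∀ g ∈ symPower K W k, π g = if k = d then g else 0 := fun k g hg => by
      change (symDegreeHom K W g).coeff d = _
      rw [symDegreeHom_apply_of_mem hg, Polynomial.coeff_monomial]
    have hle : productSpace K α ≤ (cardProductSpace K α univ {d}).comap π := by
      refine span_le.2 ?_
      rintro _ ⟨S, rfl⟩
      change π (subsetProd K α S) ∈ cardProductSpace K α univ {d}
      rw [hπ _ _ (subsetProd_mem_symPower α S)]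
      split_ifs with h
      · exact subset_span ⟨S, ⟨subset_univ S, h⟩, rfl⟩
      · exact zero_mem _
    have := hle hf
    rwa [mem_comap, hπ d f hd, if_pos rfl] at this
  · rintro _ ⟨S, ⟨-, hS⟩, rfl⟩
    refine ⟨subset_span ⟨S, rfl⟩, ?_⟩
    have := subsetProd_mem_symPower (K := K) α S
    rwa [Set.mem_singleton_iff.1 hS] at this

theorem hilbertSeries_productSpace [Fintype β] (α : β → W) :
    hilbertSeries (productSpace K α) = nullitySum K α univ PowerSeries.X := by
  rw [← mk_finrank_cardProductSpace]
  ext d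
  rw [hilbertSeries, PowerSeries.coeff_mk, PowerSeries.coeff_mk, productSpace_inf_symPower]

/-- At `t = 1` the term of `A` is `0 ^ (|A| - r(A))`, the indicator of independence. -/
theorem nullitySum_one [Fintype β] (α : β → W) :
    nullitySum K α univ (1 : ℤ) = {I : Set β | (vectorMatroid K α).Indep I}.ncard := by
  classical
  have hset : {I : Set β | (vectorMatroid K α).Indep I} =
      (fun A : Finset β => (A : Set β)) ''
        (univ.filter fun A : Finset β => LinearIndepOn K α (A : Set β) : Finset (Finset β)) := by
    ext I
    simp only [Set.mem_image, coe_filter, mem_univ, true_and]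
    exact ⟨fun h => ⟨I.toFinset, by simpa [← vectorMatroid_indep_iff] using h, by simp⟩, by rintro ⟨A, hA, rfl⟩; exact hA⟩
  rw [hset, Set.ncard_image_of_injective _ coe_injective, Set.ncard_coe_finset, card_filter,
    nullitySum, powerset_univ, Nat.cast_sum]
  refine sum_congr rfl fun A _ => ?_
  have hle := finrank_span_image_le_card (K := K) α A
  rw [one_pow, one_mul, sub_self]
  split_ifs with h
  · rw [(finrank_span_image_eq_card_iff α A).2 h, Nat.sub_self, pow_zero, Nat.cast_one]
  · have := mt (finrank_span_image_eq_card_iff (K := K) α A).1 h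
    rw [zero_pow (by omega), Nat.cast_zero]

theorem map_nullitySum {R S : Type*} [CommRing R] [CommRing S] (g : R →+* S) (α : β → W)
    (s : Finset β) (t : R) : g (nullitySum K α s t) = nullitySum K α s (g t) := by
  simp [nullitySum]

theorem tuttePoly_vectorMatroid [Fintype β] (α : β → W) :
    (vectorMatroid K α).tuttePoly = ∑ A : Finset β,
      (MvPolynomial.X 0 - 1) ^ (Module.finrank K (span K (Set.range α)) -
          Module.finrank K (span K (α '' (A : Set β)))) *
        (MvPolynomial.X 1 - 1) ^ (A.card - Module.finrank K (span K (α '' (A : Set β)))) := by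
  have hE : (vectorMatroid K α).E = Set.univ := rfl
  have : (vectorMatroid K α).ground_finite.toFinset = univ := by ext; simp [hE]
  rw [Matroid.tuttePoly, this, powerset_univ]
  simp only [vectorMatroid_natRk]
  rw [hE, Set.image_univ]

/-- The substitution `x = 1 + t`, `y = t⁻¹` turns the Tutte polynomial into `nullitySum`. -/
theorem nullitySum_eq_aeval_tuttePoly [Fintype β] {R : Type*} [CommRing R] [Algebra ℤ R]
    (α : β → W) {t t' : R}
    (htt' : t * t' = 1) :
    nullitySum K α univ t =
      t ^ (Fintype.card β - Module.finrank K (span K (Set.range α))) *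
        MvPolynomial.aeval ![1 + t, t'] (vectorMatroid K α).tuttePoly := by
  rw [tuttePoly_vectorMatroid, map_sum, mul_sum, nullitySum, powerset_univ]
  refine sum_congr rfl fun A _ => ?_
  have h1 := finrank_span_image_le_card (K := K) α A
  have h2 : Module.finrank K (span K (α '' (A : Set β))) ≤
      Module.finrank K (span K (Set.range α)) := by
    have := FiniteDimensional.span_of_finite K (Set.finite_range α)
    exact finrank_mono (span_mono (Set.image_subset_range _ _))
  have h3 : Module.finrank K (span K (Set.range α)) ≤ Fintype.card β := finrank_range_le_card α
  have h4 : A.card ≤ Fintype.card β := card_le_univ A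
  have h5 : t * (t' - 1) = 1 - t := by rw [mul_sub, htt', mul_one]
  simp only [map_mul, map_pow, map_sub, map_one, MvPolynomial.aeval_X, Matrix.cons_val_zero,
    Matrix.cons_val_one, add_sub_cancel_left]
  -- With `1 - t = t (t' - 1)`, both sides carry the power `t ^ (n - r(A))`.
  rw [← h5, mul_pow, ← mul_assoc, ← mul_assoc, ← pow_add, ← pow_add, card_univ]
  congr 2
  omega

end Assembly

theorem mainTheorem4 {K V : Type*} [Field K] [AddCommGroup V] [Module K V]
    [FiniteDimensional K V] (n : ℕ) (α : Fin n → Module.Dual K V)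
    (hα : Submodule.span K (Set.range α) = ⊤) :
    -- the identity in the ring of Laurent series in `t` over `ℤ`, where `t ^ m = single m 1`
    HahnSeries.ofPowerSeries ℤ ℤ (hilbertSeries (productSpace K α)) =
        (HahnSeries.single ((n : ℤ) - (Module.finrank K V : ℤ)) 1 : LaurentSeries ℤ) *
          MvPolynomial.aeval
            ![(1 + HahnSeries.single 1 1 : LaurentSeries ℤ), HahnSeries.single (-1) 1]
            (vectorMatroid K α).tuttePoly ∧
      Module.finrank K (productSpace K α) =
        {I : Set (Fin n) | (vectorMatroid K α).Indep I}.ncard := by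
  constructor
  · have hr : Module.finrank K (Submodule.span K (Set.range α)) = Module.finrank K V := by
      rw [hα, finrank_top, Subspace.dual_finrank_eq]
    have hle : Module.finrank K V ≤ n := by
      rw [← hr]
      exact (finrank_range_le_card α).trans_eq (Fintype.card_fin n)
    have hinv : (HahnSeries.single 1 1 : LaurentSeries ℤ) * HahnSeries.single (-1) 1 = 1 := by
      rw [HahnSeries.single_mul_single, add_neg_cancel, mul_one]; rfl
    rw [hilbertSeries_productSpace, map_nullitySum, HahnSeries.ofPowerSeries_X,
      nullitySum_eq_aeval_tuttePoly α hinv, hr, Fintype.card_fin, HahnSeries.single_pow, one_pow,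
      nsmul_one, Nat.cast_sub hle]
  · rw [← Nat.cast_inj (R := ℤ), ← nullitySum_one, ← finrank_cardProductSpace_univ,
      productSpace_eq_cardProductSpace]
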